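/- Let $G$ be a discrete group and let $1<p<\infty$, with conjugate exponent $q$, $\frac1p+\frac1q=1$. For functions on $G$ write $f^\vee(x)=f(x^{-1})$ and $(g*f)(x)=\sum_{y\in G}g(y)f(y^{-1}x)$. The Herz algebra $A_p(G)$ is the space of all functions $u=\sum_{i=1}^\infty g_i*f_i^\vee$ with $f_i\in\ell^p(G)$, $g_i\in\ell^q(G)$ and $\sum_i\|f_i\|_p\|g_i\|_q<\infty$, with pointwise multiplication and the norm $$\|u\|_{A_p(G)}=\inf\Big\{\sum_{i=1}^\infty\|f_i\|_p\|g_i\|_q : u=\sum_{i=1}^\infty g_i*f_i^\vee\Big\};$$ it contains $\ell^1(G)$. A normed space $A$ with a bounded bilinear multiplication is called Arens regular if the two Arens products on its bidual $A^{**}$ coincide, where $\langle\Phi\,\square\,\Psi,T\rangle=\langle\Phi,\Psi T\rangle$, $\langle\Psi T,a\rangle=\langle\Psi,Ta\rangle$, $\langle Ta,b\rangle=\langle T,ab\rangle$, and $\langle\Phi\,\Diamond\,\Psi,T\rangle=\langle\Psi,T\Phi\rangle$, $\langle T\Phi,a\rangle=\langle\Phi,aT\rangle$, $\langle aT,b\rangle=\langle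 T,ba\rangle$, for $\Phi,\Psi\in A^{**}$, $T\in A^*$, $a,b\in A$. Then: (i) $\ell^1(G)$ with pointwise multiplication and the norm $\|\cdot\|_1$ is Arens regular. (ii) $\ell^1(G)$ with convolution and the norm $\|\cdot\|_1$ is Arens regular if and only if $G$ is finite. (iii) $\ell^1(G)$ with convolution and the norm $\|\cdot\|_{A_p(G)}$ is not a normed algebra in general: for $G=\mathbb Z$ the norm $\|\cdot\|_{A_p(\mathbb Z)}$ is not submultiplicative with respect to convolution, that is, there are $f,g\in\ell^1(\mathbb Z)$ with $\|f*g\|_{A_p(\mathbb Z)}>\|f\|_{A_p(\mathbb Z)}\|g\|_{A_p(\mathbb Z)}$. (iv) $\ell^1(G)$ with pointwise multiplication and the norm $\|\cdot\|_{A_p(G)}$ is Arens regular if and only if $A_p(G)$ is Arens regular. -/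

import Mathlib

open scoped ENNReal

noncomputable section

/-! ## Arens products and Arens regularity -/

section Arens

variable {X Y Z : Type*} [NormedAddCommGroup X] [NormedSpace ℂ X] [NormedAddCommGroup Y]
  [NormedSpace ℂ Y] [NormedAddCommGroup Z] [NormedSpace ℂ Z]

/-- The Arens adjoint `m* : Z* × X → Y*` of a bounded bilinear map `m : X × Y → Z`, given by
`⟨m*(T, x), y⟩ = ⟨T, m(x, y)⟩`. -/
def arensAdjoint (m : X →L[ℂ] Y →L[ℂ] Z) :
    StrongDual ℂ Z →L[ℂ] X →L[ℂ] StrongDual ℂ Y :=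
  ((ContinuousLinearMap.compL ℂ X (Y →L[ℂ] Z) (Y →L[ℂ] ℂ)).flip m).comp
    (ContinuousLinearMap.compL ℂ Y Z ℂ)

@[simp] theorem arensAdjoint_apply (m : X →L[ℂ] Y →L[ℂ] Z) (T : StrongDual ℂ Z) (x : X) (y : Y) :
    arensAdjoint m T x y = T (m x y) := rfl

variable {A : Type*} [NormedAddCommGroup A] [NormedSpace ℂ A]

/-- The first Arens product on the bidual of a normed space `A` with a bounded bilinear
multiplication `m`: `⟨Φ □ Ψ, T⟩ = ⟨Φ, Ψ·T⟩`, `⟨Ψ·T, a⟩ = ⟨Ψ, T·a⟩`, `⟨T·a, b⟩ = ⟨T, ab⟩`. -/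
def firstArens (m : A →L[ℂ] A →L[ℂ] A) (Φ Ψ : StrongDual ℂ (StrongDual ℂ A)) :
    StrongDual ℂ (StrongDual ℂ A) :=
  arensAdjoint (arensAdjoint (arensAdjoint m)) Φ Ψ

/-- The second Arens product: `⟨Φ ◇ Ψ, T⟩ = ⟨Ψ, T·Φ⟩`, `⟨T·Φ, a⟩ = ⟨Φ, a·T⟩`,
`⟨a·T, b⟩ = ⟨T, ba⟩`. -/
def secondArens (m : A →L[ℂ] A →L[ℂ] A) (Φ Ψ : StrongDual ℂ (StrongDual ℂ A)) :
    StrongDual ℂ (StrongDual ℂ A) :=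
  arensAdjoint (arensAdjoint (arensAdjoint m.flip)) Ψ Φ

/-- `(A, m)` is Arens regular if the two Arens products on the bidual `A**` coincide. -/
def ArensRegular (m : A →L[ℂ] A →L[ℂ] A) : Prop :=
  ∀ Φ Ψ : StrongDual ℂ (StrongDual ℂ A), firstArens m Φ Ψ = secondArens m Φ Ψ

end Arens

/-! ## The space `ℓ¹(G)` with its pointwise and its convolution product -/

/-- Convolution of functions on a discrete group, `(f * g)(x) = ∑ y, f(y) g(y⁻¹ x)`. -/
def conv {G : Type*} [Group G] (f g : G → ℂ) (x : G) : ℂ := ∑' y, f y * g (y⁻¹ * x)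

/-- `f^∨(x) = f(x⁻¹)`. -/
def check {G : Type*} [Group G] (f : G → ℂ) (x : G) : ℂ := f x⁻¹

/-- The Banach space `ℓ¹(G)`, with the norm `‖·‖₁`. -/
abbrev L1 (G : Type*) : Type _ := lp (fun _ : G => ℂ) 1

section L1

variable {G : Type*}

theorem L1.hasSum_norm (f : L1 G) : HasSum (fun x => ‖f x‖) ‖f‖ := by
  have h := lp.hasSum_norm (p := 1) (by simp) f
  simpa using h

theorem memℓp_one_iff {f : G → ℂ} : Memℓp f 1 ↔ Summable fun x => ‖f x‖ := by
  rw [memℓp_gen_iff (by simp)]; simp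

theorem L1.norm_le {f : L1 G} {F : G → ℝ} {C : ℝ} (hF : HasSum F C) (h : ∀ x, ‖f x‖ ≤ F x) :
    ‖f‖ ≤ C := by
  rw [← (L1.hasSum_norm f).tsum_eq, ← hF.tsum_eq]
  exact (L1.hasSum_norm f).summable.tsum_le_tsum h hF.summable

theorem L1.mul_bound (f g : L1 G) (x : G) : ‖f x * g x‖ ≤ ‖f‖ * ‖g x‖ := by
  rw [norm_mul]
  exact mul_le_mul_of_nonneg_right (lp.norm_apply_le_norm one_ne_zero f x) (norm_nonneg _)

theorem L1.mem_mul (f g : L1 G) : Memℓp (fun x => f x * g x) 1 :=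
  memℓp_one_iff.2 (.of_nonneg_of_le (fun _ => norm_nonneg _) (L1.mul_bound f g)
    ((L1.hasSum_norm g).summable.mul_left _))

/-- Pointwise multiplication on `(ℓ¹(G), ‖·‖₁)`. -/
def l1PointwiseMul (G : Type*) : L1 G →L[ℂ] L1 G →L[ℂ] L1 G :=
  LinearMap.mkContinuous₂
    (LinearMap.mk₂ ℂ (fun f g : L1 G => (⟨fun x => f x * g x, L1.mem_mul f g⟩ : L1 G))
      (fun f f' g => by ext x; exact add_mul (f x) (f' x) (g x))
      (fun c f g => by ext x; exact mul_assoc c (f x) (g x))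
      (fun f g g' => by ext x; exact mul_add (f x) (g x) (g' x))
      (fun c f g => by ext x; exact mul_left_comm (f x) c (g x)))
    1 (fun f g => by
      rw [one_mul]
      exact L1.norm_le ((L1.hasSum_norm g).mul_left ‖f‖) (L1.mul_bound f g))

@[simp] theorem l1PointwiseMul_apply (f g : L1 G) (x : G) :
    l1PointwiseMul G f g x = f x * g x := rfl

variable [Group G]

/-- The bijection `(x, y) ↦ (y, y⁻¹ x)` of `G × G`. -/
def shearInv (G : Type*) [Group G] : G × G ≃ G × G where
  toFun z := (z.2, z.2⁻¹ * z.1)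
  invFun z := (z.1 * z.2, z.1)
  left_inv z := Prod.ext (mul_inv_cancel_left z.2 z.1) rfl
  right_inv z := Prod.ext rfl (inv_mul_cancel_left z.1 z.2)

/-- The bijection `(w, y) ↦ (y, y w)` of `G × G`. -/
def shear (G : Type*) [Group G] : G × G ≃ G × G where
  toFun z := (z.2, z.2 * z.1)
  invFun z := (z.1⁻¹ * z.2, z.1)
  left_inv z := Prod.ext (inv_mul_cancel_left z.2 z.1) rfl
  right_inv z := Prod.ext rfl (mul_inv_cancel_left z.1 z.2)

/-- Reindexing of an unconditional sum along a bijection. -/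
theorem hasSum_reindex {α β M : Type*} [AddCommMonoid M] [TopologicalSpace M] (e : α ≃ β)
    {F : β → M} {a : M} (h : HasSum F a) : HasSum (fun x => F (e x)) a :=
  e.hasSum_iff.2 h

/-- The product of two series with nonnegative terms. -/
theorem hasSum_mul_nonneg {α β : Type*} (a : α → ℝ) (b : β → ℝ) {r s : ℝ} (ha0 : ∀ i, 0 ≤ a i)
    (hb0 : ∀ i, 0 ≤ b i) (ha : HasSum a r) (hb : HasSum b s) :
    HasSum (fun z : α × β => a z.1 * b z.2) (r * s) :=
  HasSum.mul (f := a) (g := b) ha hb (ha.summable.mul_of_nonneg hb.summable ha0 hb0)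

/-- Summation by fibres. -/
theorem hasSum_fiberwise {α β M : Type*} [AddCommMonoid M] [TopologicalSpace M] [ContinuousAdd M]
    [RegularSpace M] {F : α → β → M} {f : α → M} {a : M}
    (h : HasSum (fun z : α × β => F z.1 z.2) a) (hF : ∀ x, HasSum (F x) (f x)) : HasSum f a :=
  h.prod_fiberwise hF

theorem L1.hasSum_prod (f g : L1 G) :
    HasSum (fun z : G × G => ‖f z.2 * g (z.2⁻¹ * z.1)‖) (‖f‖ * ‖g‖) := by
  have h : HasSum (fun z : G × G => ‖f z.1‖ * ‖g z.2‖) (‖f‖ * ‖g‖) :=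
    hasSum_mul_nonneg (fun x => ‖f x‖) (fun x => ‖g x‖) (fun _ => norm_nonneg _)
      (fun _ => norm_nonneg _) (L1.hasSum_norm f) (L1.hasSum_norm g)
  have h2 : HasSum (fun z : G × G => ‖f z.2‖ * ‖g (z.2⁻¹ * z.1)‖) (‖f‖ * ‖g‖) :=
    hasSum_reindex (shearInv G) (F := fun z : G × G => ‖f z.1‖ * ‖g z.2‖) h
  simpa only [norm_mul] using h2

theorem L1.summable_conv (f g : L1 G) (x : G) : Summable fun y => f y * g (y⁻¹ * x) :=
  ((L1.hasSum_prod f g).summable.prod_factor x).of_norm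

theorem L1.conv_bound (f g : L1 G) (x : G) :
    ‖conv f g x‖ ≤ ∑' y, ‖f y * g (y⁻¹ * x)‖ :=
  norm_tsum_le_tsum_norm ((L1.hasSum_prod f g).summable.prod_factor x)

theorem L1.hasSum_conv_bound (f g : L1 G) :
    HasSum (fun x => ∑' y, ‖f y * g (y⁻¹ * x)‖) (‖f‖ * ‖g‖) :=
  (L1.hasSum_prod f g).prod_fiberwise
    (fun x => ((L1.hasSum_prod f g).summable.prod_factor x).hasSum)

theorem L1.mem_conv (f g : L1 G) : Memℓp (conv f g) 1 :=
  memℓp_one_iff.2 (.of_nonneg_of_le (fun _ => norm_nonneg _) (L1.conv_bound f g)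
    (L1.hasSum_conv_bound f g).summable)

/-- Convolution on `(ℓ¹(G), ‖·‖₁)`. -/
def l1ConvMul (G : Type*) [Group G] : L1 G →L[ℂ] L1 G →L[ℂ] L1 G :=
  LinearMap.mkContinuous₂
    (LinearMap.mk₂ ℂ (fun f g : L1 G => (⟨conv f g, L1.mem_conv f g⟩ : L1 G))
      (fun f f' g => by
        ext x
        exact (tsum_congr fun y => add_mul (f y) (f' y) _).trans
          ((L1.summable_conv f g x).tsum_add (L1.summable_conv f' g x)))
      (fun c f g => by
        ext x
        exact (tsum_congr fun y => mul_assoc c (f y) _).trans tsum_mul_left)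
      (fun f g g' => by
        ext x
        exact (tsum_congr fun y => mul_add (f y) (g _) (g' _)).trans
          ((L1.summable_conv f g x).tsum_add (L1.summable_conv f g' x)))
      (fun c f g => by
        ext x
        exact (tsum_congr fun y => mul_left_comm (f y) c (g _)).trans tsum_mul_left))
    1 (fun f g => by
      rw [one_mul]
      exact L1.norm_le (L1.hasSum_conv_bound f g) (L1.conv_bound f g))

@[simp] theorem l1ConvMul_apply (f g : L1 G) (x : G) :
    l1ConvMul G f g x = conv f g x := rfl

end L1

/-! ## The Herz algebra `A_p(G)` of a discrete group -/

/-- The Banach space `ℓ^p(G)`, for a real exponent `p`. -/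
abbrev LpG (G : Type*) (p : ℝ) : Type _ := lp (fun _ : G => ℂ) (ENNReal.ofReal p)

/-- `HerzRep p u r`: there are sequences `f_i ∈ ℓ^p(G)`, `g_i ∈ ℓ^q(G)`, where `q` is the exponent
conjugate to `p`, with `∑ ‖f_i‖_p ‖g_i‖_q = r < ∞` and `u = ∑ g_i * f_i^∨`. -/
def HerzRep {G : Type*} [Group G] (p : ℝ) (u : G → ℂ) (r : ℝ) : Prop :=
  ∃ (f : ℕ → LpG G p) (g : ℕ → LpG G p.conjExponent),
    HasSum (fun i => ‖f i‖ * ‖g i‖) r ∧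
    ∀ x, HasSum (fun i => conv (g i) (check (f i)) x) (u x)

/-- `‖u‖_{A_p(G)}`, the infimum of `∑ ‖f_i‖_p ‖g_i‖_q` over all representations of `u`. -/
def herzNorm {G : Type*} [Group G] (p : ℝ) (u : G → ℂ) : ℝ := sInf {r | HerzRep p u r}

section Herz

variable {G : Type*} {p : ℝ}

theorem hconj (hp : 1 < p) : p.HolderConjugate p.conjExponent :=
  Real.HolderConjugate.conjExponent hp

theorem LpG.ne_zero (hp : 0 < p) : ENNReal.ofReal p ≠ 0 := by simpa using hp

theorem LpG.memℓp_iff (hp : 0 < p) {f : G → ℂ} :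
    Memℓp f (ENNReal.ofReal p) ↔ Summable fun x => ‖f x‖ ^ p := by
  rw [memℓp_gen_iff (by rwa [ENNReal.toReal_ofReal hp.le]), ENNReal.toReal_ofReal hp.le]

theorem LpG.hasSum_norm (hp : 0 < p) (f : LpG G p) :
    HasSum (fun x => ‖f x‖ ^ p) (‖f‖ ^ p) := by
  have h := lp.hasSum_norm (by rwa [ENNReal.toReal_ofReal hp.le]) f
  rwa [ENNReal.toReal_ofReal hp.le] at h

variable [Group G]

theorem conv_check (f g : G → ℂ) (x : G) :
    conv g (check f) x = ∑' y, g y * f (x⁻¹ * y) := by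
  simp [conv, check]

/-- Left translation on `ℓ^p(G)`. -/
def LpG.translate (hp : 0 < p) (x : G) (f : LpG G p) : LpG G p :=
  ⟨fun y => f (x * y), (LpG.memℓp_iff hp).2
    ((hasSum_reindex (Equiv.mulLeft x) (LpG.hasSum_norm hp f)).summable)⟩

theorem LpG.norm_translate (hp : 0 < p) (x : G) (f : LpG G p) :
    ‖LpG.translate hp x f‖ = ‖f‖ := by
  have h1 := LpG.hasSum_norm hp (LpG.translate hp x f)
  have h2 := hasSum_reindex (Equiv.mulLeft x) (LpG.hasSum_norm hp f)
  exact Real.rpow_left_injOn hp.ne' (lp.norm_nonneg' _) (lp.norm_nonneg' _) (h1.unique h2)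

theorem conv_summable (hp : 1 < p) (f : LpG G p) (g : LpG G p.conjExponent) (x : G) :
    (Summable fun y => ‖g y * f (x⁻¹ * y)‖) ∧
      ∑' y, ‖g y * f (x⁻¹ * y)‖ ≤ ‖f‖ * ‖g‖ := by
  have hpq := hconj hp
  have hpq' : (ENNReal.ofReal p).toReal.HolderConjugate
      (ENNReal.ofReal p.conjExponent).toReal := by
    rwa [ENNReal.toReal_ofReal hpq.nonneg, ENNReal.toReal_ofReal hpq.symm.nonneg]
  have h := lp.tsum_mul_le_mul_norm hpq' (LpG.translate hpq.pos x⁻¹ f) g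
  rw [LpG.norm_translate] at h
  have e : (fun y => ‖g y * f (x⁻¹ * y)‖) =
      fun y => ‖LpG.translate hpq.pos x⁻¹ f y‖ * ‖g y‖ := by
    funext y
    rw [norm_mul, mul_comm]
    rfl
  rw [e]
  exact h

theorem conv_bound (hp : 1 < p) (f : LpG G p) (g : LpG G p.conjExponent) (x : G) :
    ‖conv g (check f) x‖ ≤ ‖f‖ * ‖g‖ := by
  rw [conv_check]
  exact (norm_tsum_le_tsum_norm (conv_summable hp f g x).1).trans (conv_summable hp f g x).2

theorem HerzRep.nonneg {u : G → ℂ} {r : ℝ} (h : HerzRep p u r) : 0 ≤ r := by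
  obtain ⟨f, g, h, -⟩ := h
  exact h.nonneg fun i => mul_nonneg (lp.norm_nonneg' _) (lp.norm_nonneg' _)

theorem HerzRep.norm_apply_le (hp : 1 < p) {u : G → ℂ} {r : ℝ} (h : HerzRep p u r) (x : G) :
    ‖u x‖ ≤ r := by
  obtain ⟨f, g, h, hu⟩ := h
  rw [← (hu x).tsum_eq, ← h.tsum_eq]
  exact tsum_of_norm_bounded h.summable.hasSum fun i => conv_bound hp (f i) (g i) x

/-- Representations over an arbitrary index set give representations by sequences. -/
theorem HerzRep.of_index (hp : 1 < p) {ι : Type*} {u : G → ℂ} {r : ℝ} (f : ι → LpG G p)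
    (g : ι → LpG G p.conjExponent) (hr : HasSum (fun i => ‖f i‖ * ‖g i‖) r)
    (hu : ∀ x, HasSum (fun i => conv (g i) (check (f i)) x) (u x)) : HerzRep p u r := by
  classical
  let S : Set ι := Function.support fun i => ‖f i‖ * ‖g i‖
  have hS : S.Countable := hr.summable.countable_support
  have : Countable S := hS.to_subtype
  obtain ⟨e, he⟩ := exists_injective_nat S
  have hz : ∀ x, Function.support (fun i => conv (g i) (check (f i)) x) ⊆ S := by
    intro x i hi h0
    have h0' : ‖f i‖ * ‖g i‖ = 0 := by simpa [S] using h0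
    have := conv_bound hp (f i) (g i) x
    rw [h0'] at this
    exact hi (norm_le_zero_iff.1 this)
  refine ⟨Function.extend e (fun s => f s) 0, Function.extend e (fun s => g s) 0, ?_, ?_⟩
  · refine (he.hasSum_iff ?_).1 ?_
    · intro n hn
      simp only [Set.mem_range] at hn
      rw [Function.extend_apply' _ _ _ hn]
      simp
    · have : HasSum ((fun i => ‖f i‖ * ‖g i‖) ∘ ((↑) : S → ι)) r :=
        (hasSum_subtype_iff_of_support_subset subset_rfl).2 hr
      refine this.congr_fun ?_
      intro s
      simp [he.extend_apply]
  · intro x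
    refine (he.hasSum_iff ?_).1 ?_
    · intro n hn
      simp only [Set.mem_range] at hn
      rw [Function.extend_apply' _ _ _ hn]
      simp [conv]
    · have : HasSum ((fun i => conv (g i) (check (f i)) x) ∘ ((↑) : S → ι)) (u x) :=
        (hasSum_subtype_iff_of_support_subset (hz x)).2 (hu x)
      refine this.congr_fun ?_
      intro s
      simp [he.extend_apply]


theorem HerzRep.zero (hp : 1 < p) : HerzRep p (0 : G → ℂ) 0 :=
  .of_index hp (fun e : Empty => e.elim) (fun e => e.elim) hasSum_empty fun _ => hasSum_empty

theorem hasSum_sum_elim {X Y M : Type*} [AddCommMonoid M] [TopologicalSpace M] [ContinuousAdd M]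
    (c : X → Y → M) {f f' : ℕ → X} {g g' : ℕ → Y} {a b : M}
    (h₁ : HasSum (fun i => c (f i) (g i)) a) (h₂ : HasSum (fun i => c (f' i) (g' i)) b) :
    HasSum (fun k : ℕ ⊕ ℕ => c (Sum.elim f f' k) (Sum.elim g g' k)) (a + b) :=
  HasSum.sum (f := fun k : ℕ ⊕ ℕ => c (Sum.elim f f' k) (Sum.elim g g' k)) h₁ h₂

theorem HerzRep.add (hp : 1 < p) {u v : G → ℂ} {r s : ℝ} (hu : HerzRep p u r)
    (hv : HerzRep p v s) : HerzRep p (u + v) (r + s) := by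
  obtain ⟨f, g, hr, hu⟩ := hu
  obtain ⟨f', g', hs, hv⟩ := hv
  exact .of_index hp (Sum.elim f f') (Sum.elim g g')
    (hasSum_sum_elim (fun (f : LpG G p) (g : LpG G p.conjExponent) => ‖f‖ * ‖g‖) hr hs)
    fun x => hasSum_sum_elim
      (fun (f : LpG G p) (g : LpG G p.conjExponent) => conv g (check f) x) (hu x) (hv x)

theorem HerzRep.smul (hp : 1 < p) {u : G → ℂ} {r : ℝ} (c : ℂ) (hu : HerzRep p u r) :
    HerzRep p (c • u) (‖c‖ * r) := by
  obtain ⟨f, g, hr, hu⟩ := hu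
  refine ⟨f, fun i => c • g i, ?_, fun x => ?_⟩
  · refine (hr.mul_left ‖c‖).congr_fun ?_
    intro i
    rw [lp.norm_const_smul (LpG.ne_zero (hconj hp).symm.pos)]
    ring
  · refine ((hu x).mul_left c).congr_fun ?_
    intro i
    simp only [conv, lp.coeFn_smul, Pi.smul_apply, smul_eq_mul, mul_assoc, tsum_mul_left]

/-- The function `y ↦ f(y) f'(y w)`. -/
def LpG.twist (hp : 0 < p) (f f' : LpG G p) (w : G) : LpG G p :=
  ⟨fun y => f y * f' (y * w), (LpG.memℓp_iff hp).2 (by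
    refine .of_nonneg_of_le (fun _ => by positivity) (fun y => ?_)
      ((LpG.hasSum_norm hp f).summable.mul_right (‖f'‖ ^ p))
    rw [norm_mul, Real.mul_rpow (norm_nonneg _) (norm_nonneg _)]
    gcongr
    exact lp.norm_apply_le_norm (LpG.ne_zero hp) f' _)⟩

theorem LpG.hasSum_twist (hp : 0 < p) (f f' : LpG G p) :
    HasSum (fun w => ‖LpG.twist hp f f' w‖ ^ p) ((‖f‖ * ‖f'‖) ^ p) := by
  have hf := LpG.hasSum_norm hp f
  have hf' := LpG.hasSum_norm hp f'
  have h : HasSum (fun z : G × G => ‖f z.1‖ ^ p * ‖f' z.2‖ ^ p) (‖f‖ ^ p * ‖f'‖ ^ p) :=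
    hasSum_mul_nonneg (fun x => ‖f x‖ ^ p) (fun x => ‖f' x‖ ^ p) (fun _ => by positivity)
      (fun _ => by positivity) hf hf'
  have h2 : HasSum (fun z : G × G => ‖f z.2‖ ^ p * ‖f' (z.2 * z.1)‖ ^ p) (‖f‖ ^ p * ‖f'‖ ^ p) :=
    hasSum_reindex (shear G) (F := fun z : G × G => ‖f z.1‖ ^ p * ‖f' z.2‖ ^ p) h
  rw [Real.mul_rpow (lp.norm_nonneg' _) (lp.norm_nonneg' _)]
  have key : ∀ w, HasSum (fun y => ‖f y‖ ^ p * ‖f' (y * w)‖ ^ p) (‖LpG.twist hp f f' w‖ ^ p) := by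
    intro w
    have h3 : HasSum (fun y => ‖f y * f' (y * w)‖ ^ p) (‖LpG.twist hp f f' w‖ ^ p) :=
      LpG.hasSum_norm hp (LpG.twist hp f f' w)
    simpa only [norm_mul, Real.mul_rpow (norm_nonneg _) (norm_nonneg _)] using h3
  exact hasSum_fiberwise (F := fun w y => ‖f y‖ ^ p * ‖f' (y * w)‖ ^ p) h2 key

theorem twist_bound (hp : 1 < p) (f f' : LpG G p) (g g' : LpG G p.conjExponent) :
    (Summable fun w => ‖LpG.twist (hconj hp).pos f f' w‖ *
        ‖LpG.twist (hconj hp).symm.pos g g' w‖) ∧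
      ∑' w, ‖LpG.twist (hconj hp).pos f f' w‖ * ‖LpG.twist (hconj hp).symm.pos g g' w‖ ≤
        (‖f‖ * ‖g‖) * (‖f'‖ * ‖g'‖) := by
  obtain ⟨C, -, hC, h⟩ := Real.inner_le_Lp_mul_Lq_hasSum_of_nonneg (hconj hp)
    (mul_nonneg (lp.norm_nonneg' f) (lp.norm_nonneg' f'))
    (mul_nonneg (lp.norm_nonneg' g) (lp.norm_nonneg' g'))
    (fun _ => lp.norm_nonneg' _) (fun _ => lp.norm_nonneg' _)
    (LpG.hasSum_twist (hconj hp).pos f f') (LpG.hasSum_twist (hconj hp).symm.pos g g')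
  refine ⟨h.summable, ?_⟩
  rw [h.tsum_eq]
  exact hC.trans_eq (by ring)

theorem hasSum_mul_shift {a b : G → ℂ} (ha : Summable fun y => ‖a y‖)
    (hb : Summable fun y => ‖b y‖) :
    HasSum (fun w => ∑' y, a y * b (y * w)) ((∑' y, a y) * ∑' y, b y) := by
  have h : HasSum (fun z : G × G => a z.1 * b z.2) ((∑' y, a y) * ∑' y, b y) :=
    HasSum.mul (f := a) (g := b) ha.of_norm.hasSum hb.of_norm.hasSum (summable_mul_of_summable_norm ha hb)
  have h3 : HasSum (fun z : G × G => a z.2 * b (z.2 * z.1)) ((∑' y, a y) * ∑' y, b y) :=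
    hasSum_reindex (shear G) (F := fun z : G × G => a z.1 * b z.2) h
  exact h3.prod_fiberwise fun w => (h3.summable.prod_factor w).hasSum

theorem hasSum_conv_twist (hp : 1 < p) (f f' : LpG G p) (g g' : LpG G p.conjExponent) (x : G) :
    HasSum (fun w => conv (LpG.twist (hconj hp).symm.pos g g' w)
        (check (LpG.twist (hconj hp).pos f f' w)) x)
      (conv g (check f) x * conv g' (check f') x) := by
  have h := hasSum_mul_shift (conv_summable hp f g x).1 (conv_summable hp f' g' x).1
  rw [conv_check, conv_check]
  convert! h using 2 with w
  rw [conv_check]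
  refine tsum_congr fun y => ?_
  change (g y * g' (y * w)) * (f (x⁻¹ * y) * f' (x⁻¹ * y * w)) = _
  rw [← mul_assoc x⁻¹ y w]
  ring

/-- Bookkeeping for the product of two absolutely convergent series whose products of terms are
themselves given by series. -/
theorem hasSum_product_series {κ : Type*} {a b : ℕ → ℂ} {α β : ℕ → ℝ} {r : ℝ} {U V : ℂ}
    (ha : ∀ i, ‖a i‖ ≤ α i) (hb : ∀ i, ‖b i‖ ≤ β i) (hα : Summable α) (hβ : Summable β)
    (hU : HasSum a U) (hV : HasSum b V) {c : (ℕ × ℕ) × κ → ℂ} {C : (ℕ × ℕ) × κ → ℝ}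
    (hc : ∀ k, ‖c k‖ ≤ C k) (hC : HasSum C r)
    (hab : ∀ k : ℕ × ℕ, HasSum (fun w => c (k, w)) (a k.1 * b k.2)) :
    HasSum c (U * V) := by
  have hs : Summable c := .of_norm_bounded hC.summable hc
  have h1 : HasSum (fun k : ℕ × ℕ => a k.1 * b k.2) (∑' k, c k) := hs.hasSum.prod_fiberwise hab
  have h2 : HasSum (fun k : ℕ × ℕ => a k.1 * b k.2) (U * V) :=
    HasSum.mul hU hV (summable_mul_of_summable_norm
      (.of_nonneg_of_le (fun _ => norm_nonneg _) ha hα)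
      (.of_nonneg_of_le (fun _ => norm_nonneg _) hb hβ))
  rw [← h1.unique h2]
  exact hs.hasSum

theorem hasSum_product_bound {κ : Type*} {α β : ℕ → ℝ} {r s : ℝ}
    (hα0 : ∀ i, 0 ≤ α i) (hβ0 : ∀ i, 0 ≤ β i) (hα : HasSum α r) (hβ : HasSum β s)
    {C : (ℕ × ℕ) × κ → ℝ} (hC0 : ∀ k, 0 ≤ C k)
    (hC : ∀ k : ℕ × ℕ, (Summable fun w => C (k, w)) ∧ ∑' w, C (k, w) ≤ α k.1 * β k.2) :
    ∃ t ≤ r * s, HasSum C t := by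
  have hrs : HasSum (fun k : ℕ × ℕ => α k.1 * β k.2) (r * s) :=
    hasSum_mul_nonneg α β hα0 hβ0 hα hβ
  have hs : Summable C := (summable_prod_of_nonneg hC0).2 ⟨fun k => (hC k).1,
    .of_nonneg_of_le (fun k => tsum_nonneg fun w => hC0 (k, w)) (fun k => (hC k).2) hrs.summable⟩
  refine ⟨_, ?_, hs.hasSum⟩
  have h1 := hs.hasSum.prod_fiberwise fun k => (hC k).1.hasSum
  rw [← h1.tsum_eq, ← hrs.tsum_eq]
  exact h1.summable.tsum_le_tsum (fun k => (hC k).2) hrs.summable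

/-- The pointwise product of two elements of `A_p(G)` is in `A_p(G)`. -/
theorem HerzRep.mul (hp : 1 < p) {u v : G → ℂ} {r s : ℝ} (hu : HerzRep p u r)
    (hv : HerzRep p v s) : ∃ t ≤ r * s, HerzRep p (u * v) t := by
  obtain ⟨f, g, hr, hu⟩ := hu
  obtain ⟨f', g', hs, hv⟩ := hv
  let F : (ℕ × ℕ) × G → LpG G p := fun k => LpG.twist (hconj hp).pos (f k.1.1) (f' k.1.2) k.2
  let H : (ℕ × ℕ) × G → LpG G p.conjExponent :=
    fun k => LpG.twist (hconj hp).symm.pos (g k.1.1) (g' k.1.2) k.2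
  obtain ⟨t, ht, hFH⟩ := hasSum_product_bound (C := fun k => ‖F k‖ * ‖H k‖)
    (fun _ => mul_nonneg (lp.norm_nonneg' _) (lp.norm_nonneg' _))
    (fun _ => mul_nonneg (lp.norm_nonneg' _) (lp.norm_nonneg' _)) hr hs
    (fun _ => mul_nonneg (lp.norm_nonneg' _) (lp.norm_nonneg' _))
    (fun k => twist_bound hp (f k.1) (f' k.2) (g k.1) (g' k.2))
  refine ⟨t, ht, .of_index hp F H hFH fun x => ?_⟩
  exact hasSum_product_series (c := fun k => conv (H k) (check (F k)) x)
    (fun i => conv_bound hp (f i) (g i) x) (fun i => conv_bound hp (f' i) (g' i) x)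
    hr.summable hs.summable (hu x) (hv x) (fun k => conv_bound hp (F k) (H k) x) hFH
    (fun k => hasSum_conv_twist hp (f k.1) (f' k.2) (g k.1) (g' k.2) x)

/-- `ℓ¹(G)` is contained in `A_p(G)`, and `‖f‖_{A_p(G)} ≤ ‖f‖₁`. -/
theorem HerzRep.of_l1 (hp : 1 < p) (f : L1 G) : HerzRep p f ‖f‖ := by
  classical
  refine .of_index hp (fun _ : G => lp.single _ 1 (1 : ℂ)) (fun a => lp.single _ a (f a))
    ?_ fun x => ?_
  · refine (L1.hasSum_norm f).congr_fun ?_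
    intro a
    rw [lp.norm_single (by simpa using (hconj hp).pos),
      lp.norm_single (by simpa using (hconj hp).symm.pos)]
    simp
  · have h : ∀ a, conv (lp.single (ENNReal.ofReal p.conjExponent) a (f a) : G → ℂ)
        (check (lp.single (ENNReal.ofReal p) (1 : G) (1 : ℂ) : G → ℂ)) x =
          if a = x then f x else 0 := by
      intro a
      rw [conv_check, tsum_eq_single x]
      · by_cases hax : a = x
        · subst hax; simp
        · simp [hax, lp.single_apply, Ne.symm hax]
      · intro y hy
        have : x⁻¹ * y ≠ 1 := fun h => hy (inv_mul_eq_one.1 h).symm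
        simp [lp.single_apply, Pi.single_apply, this]
    simp only [h]
    exact hasSum_ite_eq x (f x)

theorem herzNorm_bddBelow (u : G → ℂ) : BddBelow {r | HerzRep p u r} :=
  ⟨0, fun _ hr => hr.nonneg⟩

theorem herzNorm_le {u : G → ℂ} {r : ℝ} (h : HerzRep p u r) : herzNorm p u ≤ r :=
  csInf_le (herzNorm_bddBelow u) h

theorem exists_herzRep_lt {u : G → ℂ} (hu : ∃ r, HerzRep p u r) {ε : ℝ} (hε : 0 < ε) :
    ∃ r < herzNorm p u + ε, HerzRep p u r := by
  obtain ⟨r, hr, h⟩ := exists_lt_of_csInf_lt (s := {r | HerzRep p u r}) hu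
    (lt_add_of_pos_right _ hε)
  exact ⟨r, h, hr⟩

theorem herzNorm_nonneg (u : G → ℂ) : 0 ≤ herzNorm p u :=
  Real.sInf_nonneg fun _ hr => HerzRep.nonneg hr

theorem herzNorm_add_le (hp : 1 < p) {u v : G → ℂ} (hu : ∃ r, HerzRep p u r)
    (hv : ∃ r, HerzRep p v r) : herzNorm p (u + v) ≤ herzNorm p u + herzNorm p v := by
  refine le_of_forall_pos_le_add fun ε hε => ?_
  obtain ⟨r, h1, hr⟩ := exists_herzRep_lt hu (half_pos hε)
  obtain ⟨s, h2, hs⟩ := exists_herzRep_lt hv (half_pos hε)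
  have := herzNorm_le (hr.add hp hs)
  linarith

theorem herzNorm_mul_le (hp : 1 < p) {u v : G → ℂ} (hu : ∃ r, HerzRep p u r)
    (hv : ∃ r, HerzRep p v r) : herzNorm p (u * v) ≤ herzNorm p u * herzNorm p v := by
  have key : ∀ r, HerzRep p u r → ∀ s, HerzRep p v s → herzNorm p (u * v) ≤ r * s := by
    intro r hr s hs
    obtain ⟨t, ht, h⟩ := hr.mul hp hs
    exact (herzNorm_le h).trans ht
  have key2 : ∀ ε > 0, herzNorm p (u * v) ≤ (herzNorm p u + ε) * (herzNorm p v + ε) := by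
    intro ε hε
    obtain ⟨r, h1, hr⟩ := exists_herzRep_lt hu hε
    obtain ⟨s, h2, hs⟩ := exists_herzRep_lt hv hε
    exact (key r hr s hs).trans (mul_le_mul h1.le h2.le hs.nonneg (hr.nonneg.trans h1.le))
  have hc : Filter.Tendsto (fun ε : ℝ => (herzNorm p u + ε) * (herzNorm p v + ε))
      (nhdsWithin 0 (Set.Ioi 0)) (nhds (herzNorm p u * herzNorm p v)) := by
    have : Continuous fun ε : ℝ => (herzNorm p u + ε) * (herzNorm p v + ε) := by fun_prop
    have h := (this.tendsto 0).mono_left (nhdsWithin_le_nhds (s := Set.Ioi 0))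
    simpa using h
  exact ge_of_tendsto hc (Filter.eventually_of_mem self_mem_nhdsWithin key2)

theorem herzNorm_smul_le (hp : 1 < p) (c : ℂ) {u : G → ℂ} (hu : ∃ r, HerzRep p u r) :
    herzNorm p (c • u) ≤ ‖c‖ * herzNorm p u := by
  rcases eq_or_ne c 0 with rfl | hc
  · simpa using herzNorm_le (HerzRep.zero (G := G) hp)
  · rw [← div_le_iff₀' (norm_pos_iff.2 hc)]
    refine le_csInf hu fun r hr => ?_
    rw [div_le_iff₀' (norm_pos_iff.2 hc)]
    exact herzNorm_le (hr.smul hp c)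

theorem norm_apply_le_herzNorm (hp : 1 < p) {u : G → ℂ} (hu : ∃ r, HerzRep p u r) (x : G) :
    ‖u x‖ ≤ herzNorm p u :=
  le_csInf hu fun _ hr => hr.norm_apply_le hp x

end Herz

/-- The underlying subspace of `A_p(G)` in the space of all functions on `G`. -/
def herzSubmodule (p : ℝ) [hp : Fact (1 < p)] (G : Type*) [Group G] : Submodule ℂ (G → ℂ) where
  carrier := {u | ∃ r, HerzRep p u r}
  add_mem' := fun ⟨_, hu⟩ ⟨_, hv⟩ => ⟨_, hu.add hp.out hv⟩
  zero_mem' := ⟨0, .zero hp.out⟩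
  smul_mem' := fun c _ ⟨_, hu⟩ => ⟨_, hu.smul hp.out c⟩

/-- The Herz algebra `A_p(G)` of the discrete group `G`, for `1 < p < ∞`. -/
def HerzAlgebra (p : ℝ) [Fact (1 < p)] (G : Type*) [Group G] : Type _ := herzSubmodule p G

section HerzAlgebra

variable {p : ℝ} [hp : Fact (1 < p)] {G : Type*} [Group G]

instance : AddCommGroup (HerzAlgebra p G) := (herzSubmodule p G).addCommGroup

instance : Module ℂ (HerzAlgebra p G) := (herzSubmodule p G).module

instance : CoeFun (HerzAlgebra p G) fun _ => G → ℂ := ⟨fun u => u.1⟩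

instance : Norm (HerzAlgebra p G) := ⟨fun u => herzNorm p u⟩

theorem HerzAlgebra.norm_def (u : HerzAlgebra p G) : ‖u‖ = herzNorm p u := rfl

theorem HerzAlgebra.ext {u v : HerzAlgebra p G} (h : ∀ x, u x = v x) : u = v :=
  Subtype.ext (funext h)

theorem HerzAlgebra.normCore : NormedSpace.Core ℂ (HerzAlgebra p G) where
  norm_nonneg u := herzNorm_nonneg _
  norm_smul c u := by
    refine le_antisymm (herzNorm_smul_le hp.out c u.2) ?_
    rcases eq_or_ne c 0 with rfl | hc
    · rw [norm_zero, zero_mul]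
      exact herzNorm_nonneg _
    · have h := herzNorm_smul_le hp.out c⁻¹ (c • u).2
      have e : c⁻¹ • (c • u).1 = u.1 := inv_smul_smul₀ hc u.1
      rw [e, norm_inv] at h
      rwa [← le_inv_mul_iff₀ (norm_pos_iff.2 hc)]
  norm_triangle u v := herzNorm_add_le hp.out u.2 v.2
  norm_eq_zero_iff u := by
    constructor
    · intro h
      refine HerzAlgebra.ext fun x => ?_
      have := norm_apply_le_herzNorm hp.out u.2 x
      rw [← HerzAlgebra.norm_def, h] at this
      exact norm_le_zero_iff.1 this
    · rintro rfl
      exact le_antisymm (herzNorm_le (.zero hp.out)) (herzNorm_nonneg _)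

instance : NormedAddCommGroup (HerzAlgebra p G) := .ofCore HerzAlgebra.normCore

instance : NormedSpace ℂ (HerzAlgebra p G) := .ofCore HerzAlgebra.normCore

/-- Pointwise multiplication on `(A_p(G), ‖·‖_{A_p(G)})`. -/
def herzMul (p : ℝ) [hp : Fact (1 < p)] (G : Type*) [Group G] :
    HerzAlgebra p G →L[ℂ] HerzAlgebra p G →L[ℂ] HerzAlgebra p G :=
  LinearMap.mkContinuous₂
    (LinearMap.mk₂ ℂ (fun u v : HerzAlgebra p G => (⟨fun x => u x * v x, by
          obtain ⟨r, hr⟩ := u.2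
          obtain ⟨s, hs⟩ := v.2
          obtain ⟨t, -, ht⟩ := hr.mul hp.out hs
          exact ⟨t, ht⟩⟩ : HerzAlgebra p G))
      (fun u u' v => HerzAlgebra.ext fun x => add_mul (u x) (u' x) (v x))
      (fun c u v => HerzAlgebra.ext fun x => mul_assoc c (u x) (v x))
      (fun u v v' => HerzAlgebra.ext fun x => mul_add (u x) (v x) (v' x))
      (fun c u v => HerzAlgebra.ext fun x => mul_left_comm (u x) c (v x)))
    1 (fun u v => by
      rw [one_mul]
      exact herzNorm_mul_le hp.out u.2 v.2)

@[simp] theorem herzMul_apply (u v : HerzAlgebra p G) (x : G) :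
    herzMul p G u v x = u x * v x := rfl

/-- The inclusion `ℓ¹(G) ⊆ A_p(G)`. -/
def l1ToHerz (p : ℝ) [hp : Fact (1 < p)] (G : Type*) [Group G] : L1 G →ₗ[ℂ] HerzAlgebra p G where
  toFun f := ⟨f, _, .of_l1 hp.out f⟩
  map_add' _ _ := rfl
  map_smul' _ _ := rfl

/-- The normed space `(ℓ¹(G), ‖·‖_{A_p(G)})`: the vector space `ℓ¹(G)`, with the norm that it
inherits from `A_p(G)`. -/
def HerzL1 (p : ℝ) [Fact (1 < p)] (G : Type*) [Group G] : Type _ := L1 G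

instance : AddCommGroup (HerzL1 p G) := inferInstanceAs (AddCommGroup (L1 G))

instance : Module ℂ (HerzL1 p G) := inferInstanceAs (Module ℂ (L1 G))

/-- The identity map from `(ℓ¹(G), ‖·‖₁)` to `(ℓ¹(G), ‖·‖_{A_p(G)})`. -/
def toHerzL1 (p : ℝ) [Fact (1 < p)] (G : Type*) [Group G] : L1 G ≃ₗ[ℂ] HerzL1 p G :=
  LinearEquiv.refl ℂ (L1 G)

/-- The inclusion `(ℓ¹(G), ‖·‖_{A_p(G)}) ⊆ A_p(G)`. -/
def HerzL1.incl (p : ℝ) [Fact (1 < p)] (G : Type*) [Group G] : HerzL1 p G →ₗ[ℂ] HerzAlgebra p G :=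
  (l1ToHerz p G).comp (toHerzL1 p G).symm.toLinearMap

theorem HerzL1.incl_injective : Function.Injective (HerzL1.incl p G) := fun f g h => by
  have h' : ((toHerzL1 p G).symm f : G → ℂ) = (toHerzL1 p G).symm g :=
    congrArg (fun u : HerzAlgebra p G => (u : G → ℂ)) h
  exact (toHerzL1 p G).symm.injective (lp.ext h')

instance : NormedAddCommGroup (HerzL1 p G) :=
  .induced (HerzL1 p G) (HerzAlgebra p G) (HerzL1.incl p G) HerzL1.incl_injective

instance : NormedSpace ℂ (HerzL1 p G) :=
  .induced ℂ (HerzL1 p G) (HerzAlgebra p G) (HerzL1.incl p G)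

theorem HerzL1.norm_def (f : HerzL1 p G) : ‖f‖ = herzNorm p ((toHerzL1 p G).symm f) := rfl

/-- Pointwise multiplication on `(ℓ¹(G), ‖·‖_{A_p(G)})`. -/
def herzL1Mul (p : ℝ) [hp : Fact (1 < p)] (G : Type*) [Group G] :
    HerzL1 p G →L[ℂ] HerzL1 p G →L[ℂ] HerzL1 p G :=
  LinearMap.mkContinuous₂
    (LinearMap.mk₂ ℂ
      (fun f g : HerzL1 p G => toHerzL1 p G
        (l1PointwiseMul G ((toHerzL1 p G).symm f) ((toHerzL1 p G).symm g)))
      (fun f f' g => by simp) (fun c f g => by simp)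
      (fun f g g' => by simp) (fun c f g => by simp))
    1 (fun f g => by
      rw [one_mul]
      exact herzNorm_mul_le hp.out (HerzL1.incl p G f).2 (HerzL1.incl p G g).2)

@[simp] theorem herzL1Mul_apply (f g : HerzL1 p G) (x : G) :
    (toHerzL1 p G).symm (herzL1Mul p G f g) x =
      (toHerzL1 p G).symm f x * (toHerzL1 p G).symm g x := rfl

/-- Convolution on `ℓ¹(G)`, regarded as a product on `(ℓ¹(G), ‖·‖_{A_p(G)})`. -/
def herzL1Conv (p : ℝ) [Fact (1 < p)] (G : Type*) [Group G] (f g : HerzL1 p G) : HerzL1 p G :=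
  toHerzL1 p G (l1ConvMul G ((toHerzL1 p G).symm f) ((toHerzL1 p G).symm g))

end HerzAlgebra

end

/-! Three mechanisms carry the proof.

Regularity by reflexivity (`ArensRegular.of_factor`): suppose `m a b = M (J a) (J b)` with `J : A →
H` and `H` reflexive. An element of `A**` acts on the functionals pulled back along `J` as
evaluation at a point of `H`. If `Φ` and `Ψ` correspond to `v` and `w`, both Arens products take the
value `T (M v w)` at `T`. Pointwise multiplication on `ℓ¹` factors in this way through the Hilbert
space `ℓ²`, by Cauchy–Schwarz. For finite `G`, `ℓ¹(G)` is itself reflexive and `J` is the identity.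

Irregularity by iterated limits (`ArensRegular.eq_of_double_limit`): weak-star cluster points of two
bounded sequences turn the two Arens products into the two iterated limits of `T (m (a i) (b j))`,
so regularity forces these to agree. In an infinite group one can choose `x i`, `y j` so that no
product with `i < j` equals one with `j < i` (`exists_seq_mul_ne`). Summation over the first set of
products then separates the limits for point masses under convolution.

Transfer by density (`arensRegular_iff_of_denseRange`): restriction identifies the dual of a normed
algebra with that of a dense subalgebra, and this identification respects both Arens products. It
applies because finite sums of convolutions of point masses are dense in `A_p(G)`
(`HerzL1.denseRange_incl`).

The failure of submultiplicativity on `ℤ` is an explicit example: one representation bounds the Herz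
norm from above, and the value at the identity bounds it from below. -/

noncomputable section

/-! ### Criteria for Arens regularity: reflexive factorization, iterated limits, dense subalgebras
-/

section ArensTransfer

variable {A : Type*} [NormedAddCommGroup A] [NormedSpace ℂ A]

/-- A product that factors through a bounded bilinear map on a reflexive space is Arens regular. -/
theorem ArensRegular.of_factor {H : Type*} [NormedAddCommGroup H] [NormedSpace ℂ H]
    (hH : Function.Surjective (NormedSpace.inclusionInDoubleDual ℂ H))
    {m : A →L[ℂ] A →L[ℂ] A} (J : A →L[ℂ] H) (M : H →L[ℂ] H →L[ℂ] A)
    (hm : ∀ a b, m a b = M (J a) (J b)) : ArensRegular m := by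
  have key : ∀ Φ : StrongDual ℂ (StrongDual ℂ A), ∃ v : H, ∀ l : StrongDual ℂ H,
      Φ (l.comp J) = l v := by
    intro Φ
    -- Precomposing `Φ` with `l ↦ l ∘ J` gives an element of `H**`, which reflexivity represents by
    -- a point.
    obtain ⟨v, hv⟩ := hH (Φ.comp ((ContinuousLinearMap.compL ℂ A H ℂ).flip J))
    exact ⟨v, fun l => (DFunLike.congr_fun hv l).symm⟩
  intro Φ Ψ
  obtain ⟨v, hv⟩ := key Φ
  obtain ⟨w, hw⟩ := key Ψ
  ext T
  -- `B x y = T (M x y)` is a bilinear form on `H`; both Arens products at `T` will evaluate to `B v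
  -- w`.
  let B : H →L[ℂ] StrongDual ℂ H := (ContinuousLinearMap.compL ℂ H A ℂ T).comp M
  have hB : ∀ x y, B x y = T (M x y) := fun _ _ => rfl
  have h1 : arensAdjoint (arensAdjoint m) Ψ T = (B.flip w).comp J := by
    ext a
    have : arensAdjoint m T a = (B (J a)).comp J := by
      ext b
      simp [hm, hB]
    change Ψ (arensAdjoint m T a) = B (J a) w
    rw [this, hw]
  have h2 : arensAdjoint (arensAdjoint m.flip) Φ T = (B v).comp J := by
    ext b
    have : arensAdjoint m.flip T b = (B.flip (J b)).comp J := by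
      ext a
      simp [hm, hB]
    change Φ (arensAdjoint m.flip T b) = B v (J b)
    rw [this, hv]
    rfl
  change Φ (arensAdjoint (arensAdjoint m) Ψ T) = Ψ (arensAdjoint (arensAdjoint m.flip) Φ T)
  rw [h1, h2, hv, hw]
  rfl

/-- The Riesz theorem applied twice. The Riesz map `D` is conjugate linear, so `x ↦ conj (Φ (D x))`
is a linear functional, and its Riesz vector is the one that represents `Φ`. -/
theorem inclusionInDoubleDual_surjective_of_innerProductSpace (H : Type*) [NormedAddCommGroup H]
    [InnerProductSpace ℂ H] [CompleteSpace H] :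
    Function.Surjective (NormedSpace.inclusionInDoubleDual ℂ H) := by
  intro Φ
  let D := InnerProductSpace.toDual ℂ H
  let l : StrongDual ℂ H := LinearMap.mkContinuous
    { toFun := fun x => starRingEnd ℂ (Φ (D x))
      map_add' := fun x y => by simp
      map_smul' := fun c x => by
        rw [map_smulₛₗ D, map_smul, smul_eq_mul, map_mul, Complex.conj_conj]
        rfl } ‖Φ‖ (fun x => by
        simpa using Φ.le_opNorm (D x))
  refine ⟨D.symm l, ?_⟩
  ext f
  obtain ⟨x, rfl⟩ := D.surjective f
  rw [NormedSpace.dual_def, InnerProductSpace.toDual_apply_apply, ← inner_conj_symm,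
    InnerProductSpace.toDual_symm_apply]
  exact Complex.conj_conj _

/-- Every linear functional on a finite-dimensional space is continuous, so algebraic reflexivity
suffices. -/
theorem inclusionInDoubleDual_surjective_of_finiteDimensional (H : Type*) [NormedAddCommGroup H]
    [NormedSpace ℂ H] [FiniteDimensional ℂ H] :
    Function.Surjective (NormedSpace.inclusionInDoubleDual ℂ H) := by
  intro Φ
  obtain ⟨v, hv⟩ := (Module.evalEquiv ℂ H).surjective
    (Φ.toLinearMap.comp (LinearMap.toContinuousLinearMap (𝕜 := ℂ) (E := H) (F' := ℂ)).toLinearMap)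
  refine ⟨v, ?_⟩
  ext f
  exact DFunLike.congr_fun hv f.toLinearMap

/-- Banach–Alaoglu: the images of the `a n` in the bidual lie in a weak-star compact ball, so they
converge weak-star along any ultrafilter. -/
theorem exists_limit_functional (a : ℕ → A) {C : ℝ} (ha : ∀ n, ‖a n‖ ≤ C) (U : Ultrafilter ℕ) :
    ∃ Φ : StrongDual ℂ (StrongDual ℂ A), ∀ T : StrongDual ℂ A,
      Filter.Tendsto (fun n => T (a n)) U (nhds (Φ T)) := by
  let e : ℕ → WeakDual ℂ (StrongDual ℂ A) := fun n =>
    StrongDual.toWeakDual (NormedSpace.inclusionInDoubleDual ℂ A (a n))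
  have hK := WeakDual.isCompact_closedBall (𝕜 := ℂ) (E := StrongDual ℂ A) 0 C
  obtain ⟨Φ, -, hΦ⟩ := hK.ultrafilter_le_nhds (U.map e) (by
    rw [Filter.le_principal_iff, Ultrafilter.coe_map, Filter.mem_map]
    refine Filter.univ_mem' fun n => ?_
    exact mem_closedBall_zero_iff.2 ((NormedSpace.double_dual_bound ℂ A (a n)).trans (ha n)))
  refine ⟨WeakDual.toStrongDual Φ, fun T => ?_⟩
  exact ((WeakDual.eval_continuous T).tendsto Φ).comp (Filter.tendsto_map'_iff.2 hΦ)

/-- The double limit criterion, for limits that are eventually constant. -/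
theorem ArensRegular.eq_of_double_limit {m : A →L[ℂ] A →L[ℂ] A} (hm : ArensRegular m)
    {a b : ℕ → A} {C : ℝ} (ha : ∀ n, ‖a n‖ ≤ C) (hb : ∀ n, ‖b n‖ ≤ C) (T : StrongDual ℂ A)
    {s t : ℂ} (hs : ∀ i j, i < j → T (m (a i) (b j)) = s)
    (ht : ∀ i j, j < i → T (m (a i) (b j)) = t) : s = t := by
  -- The ultrafilter is nonprincipal, so every tail belongs to it and finitely many indices never
  -- matter.
  let U : Ultrafilter ℕ := Filter.hyperfilter ℕ
  have hU : ∀ k, ∀ᶠ n in (U : Filter ℕ), k < n := fun k =>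
    Filter.Eventually.filter_mono (Nat.hyperfilter_le_atTop) (Filter.eventually_gt_atTop k)
  obtain ⟨Φ, hΦ⟩ := exists_limit_functional a ha U
  obtain ⟨Ψ, hΨ⟩ := exists_limit_functional b hb U
  have h := DFunLike.congr_fun (hm Φ Ψ) T
  change Φ (arensAdjoint (arensAdjoint m) Ψ T) = Ψ (arensAdjoint (arensAdjoint m.flip) Φ T) at h
  -- This is the iterated limit with `j` inner: for fixed `i` the terms are eventually `s`. In `h2`
  -- the inner limit is over `i` instead, and gives `t`.
  have h1 : Φ (arensAdjoint (arensAdjoint m) Ψ T) = s := by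
    refine tendsto_nhds_unique (hΦ _) (tendsto_const_nhds.congr fun i => ?_)
    change s = Ψ (arensAdjoint m T (a i))
    refine tendsto_nhds_unique (tendsto_const_nhds.congr' ?_) (hΨ _)
    filter_upwards [hU i] with j hj
    exact (hs i j hj).symm
  have h2 : Ψ (arensAdjoint (arensAdjoint m.flip) Φ T) = t := by
    refine tendsto_nhds_unique (hΨ _) (tendsto_const_nhds.congr fun j => ?_)
    change t = Φ (arensAdjoint m.flip T (b j))
    refine tendsto_nhds_unique (tendsto_const_nhds.congr' ?_) (hΦ _)
    filter_upwards [hU j] with i hi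
    exact (ht i j hi).symm
  rw [← h1, ← h2, h]

/-- Arens regularity passes between a normed algebra and a dense subalgebra. -/
theorem arensRegular_iff_of_denseRange {D : Type*} [NormedAddCommGroup D] [NormedSpace ℂ D]
    {mD : D →L[ℂ] D →L[ℂ] D} {mA : A →L[ℂ] A →L[ℂ] A} (i : D →ₗᵢ[ℂ] A) (hi : DenseRange i)
    (hmul : ∀ a b, i (mD a b) = mA (i a) (i b)) : ArensRegular mD ↔ ArensRegular mA := by
  have hle : ∀ l : StrongDual ℂ D,
      ‖l.extend i.toContinuousLinearMap‖ ≤ ((1 : NNReal) : ℝ) * ‖l‖ := fun l =>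
    ContinuousLinearMap.opNorm_extend_le l (N := 1) hi (fun x => by simp)
  have hext : ∀ (l : StrongDual ℂ D) x, l.extend i.toContinuousLinearMap (i x) = l x := fun l x =>
    ContinuousLinearMap.extend_eq l (e := i.toContinuousLinearMap) hi
      i.isometry.isUniformInducing x
  have huniq : ∀ S T : StrongDual ℂ A, (∀ x, S (i x) = T (i x)) → S = T := fun S T h =>
    DFunLike.coe_injective (hi.equalizer S.continuous T.continuous (funext h))
  -- `R` restricts functionals to `D` and `E` extends them by continuity. They are mutually inverse,
  -- so `A*` and `D*`, hence also the biduals, are identified.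
  let R : StrongDual ℂ A →L[ℂ] StrongDual ℂ D :=
    (ContinuousLinearMap.compL ℂ D A ℂ).flip i.toContinuousLinearMap
  let E : StrongDual ℂ D →L[ℂ] StrongDual ℂ A := LinearMap.mkContinuous
    { toFun := fun l => l.extend i.toContinuousLinearMap
      map_add' := fun l l' => huniq _ _ fun x => by simp [hext]
      map_smul' := fun c l => huniq _ _ fun x => by simp [hext] } 1 hle
  have hE : ∀ l x, E l (i x) = l x := hext
  have hRE : ∀ l, R (E l) = l := fun l => by ext x; exact hE l x
  have hER : ∀ T, E (R T) = T := fun T => huniq _ _ fun x => hE (R T) x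
  have first : ∀ Φ Ψ T, firstArens mA (Φ.comp R) (Ψ.comp R) T = firstArens mD Φ Ψ (R T) := by
    intro Φ Ψ T
    change Φ (R (arensAdjoint (arensAdjoint mA) (Ψ.comp R) T)) =
      Φ (arensAdjoint (arensAdjoint mD) Ψ (R T))
    congr 1
    ext d
    change Ψ (R (arensAdjoint mA T (i d))) = Ψ (arensAdjoint mD (R T) d)
    congr 1
    ext e
    exact congrArg T (hmul d e).symm
  have second : ∀ Φ Ψ T, secondArens mA (Φ.comp R) (Ψ.comp R) T = secondArens mD Φ Ψ (R T) := by
    intro Φ Ψ T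
    change Ψ (R (arensAdjoint (arensAdjoint mA.flip) (Φ.comp R) T)) =
      Ψ (arensAdjoint (arensAdjoint mD.flip) Φ (R T))
    congr 1
    ext d
    change Φ (R (arensAdjoint mA.flip T (i d))) = Φ (arensAdjoint mD.flip (R T) d)
    congr 1
    ext e
    exact congrArg T (hmul e d).symm
  constructor
  · intro h Φ Ψ
    -- Every element of `A**` comes from `D**` because `E ∘ R` is the identity; the converse
    -- direction uses that `R ∘ E` is the identity.
    have hc : ∀ Θ : StrongDual ℂ (StrongDual ℂ A), (Θ.comp E).comp R = Θ := fun Θ => by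
      ext T
      exact congrArg Θ (hER T)
    ext T
    have := first (Φ.comp E) (Ψ.comp E) T
    rw [h, ← second, hc, hc] at this
    exact this
  · intro h Φ Ψ
    ext l
    rw [← hRE l, ← first, ← second, h]

end ArensTransfer

/-! ### Pointwise multiplication on `ℓ¹(G)` through `ℓ²(G)` -/

section L1Regular

variable {G : Type*}

theorem L1.summable_sq (f : L1 G) : Memℓp (f : G → ℂ) 2 :=
  (lp.memℓp f).of_exponent_ge one_le_two

/-- The inclusion `ℓ¹(G) ⊆ ℓ²(G)`, as a linear map. -/
def l1ToL2Lin (G : Type*) : L1 G →ₗ[ℂ] lp (fun _ : G => ℂ) 2 where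
  toFun f := ⟨f, L1.summable_sq f⟩
  map_add' _ _ := lp.ext rfl
  map_smul' _ _ := lp.ext rfl

theorem l1ToL2Lin_norm_le (f : L1 G) : ‖l1ToL2Lin G f‖ ≤ ‖f‖ := by
  have h := lp.hasSum_norm (p := 2) (by simp) (l1ToL2Lin G f)
  simp only [ENNReal.toReal_ofNat, Real.rpow_ofNat] at h
  have h2 := (L1.hasSum_norm f).mul_left ‖f‖
  -- The squared norms are compared termwise, through `|f x|² ≤ ‖f‖₁ |f x|`.
  refine abs_le_of_sq_le_sq' ?_ (norm_nonneg _) |>.2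
  rw [sq ‖f‖]
  refine hasSum_le (fun x => ?_) h h2
  rw [sq]
  exact mul_le_mul_of_nonneg_right (lp.norm_apply_le_norm one_ne_zero f x) (norm_nonneg _)

/-- The inclusion `ℓ¹(G) ⊆ ℓ²(G)`. -/
def l1ToL2 (G : Type*) : L1 G →L[ℂ] lp (fun _ : G => ℂ) 2 :=
  (l1ToL2Lin G).mkContinuous 1 fun f => (l1ToL2Lin_norm_le f).trans_eq (one_mul _).symm

theorem l2_mul_summable (f g : lp (fun _ : G => ℂ) 2) :
    (Summable fun x => ‖f x‖ * ‖g x‖) ∧ ∑' x, ‖f x‖ * ‖g x‖ ≤ ‖f‖ * ‖g‖ :=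
  lp.tsum_mul_le_mul_norm (by simpa using Real.HolderConjugate.two_two) f g

theorem l2_mul_mem (f g : lp (fun _ : G => ℂ) 2) : Memℓp (fun x => f x * g x) 1 :=
  memℓp_one_iff.2 (by simpa only [norm_mul] using (l2_mul_summable f g).1)

/-- Pointwise multiplication `ℓ²(G) × ℓ²(G) → ℓ¹(G)`. -/
def l2Mul (G : Type*) :
    lp (fun _ : G => ℂ) 2 →L[ℂ] lp (fun _ : G => ℂ) 2 →L[ℂ] L1 G :=
  LinearMap.mkContinuous₂
    (LinearMap.mk₂ ℂ (fun f g => (⟨fun x => f x * g x, l2_mul_mem f g⟩ : L1 G))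
      (fun f f' g => by ext x; exact add_mul (f x) (f' x) (g x))
      (fun c f g => by ext x; exact mul_assoc c (f x) (g x))
      (fun f g g' => by ext x; exact mul_add (f x) (g x) (g' x))
      (fun c f g => by ext x; exact mul_left_comm (f x) c (g x)))
    1 (fun f g => by
      rw [one_mul]
      exact (L1.norm_le (l2_mul_summable f g).1.hasSum fun x => (norm_mul _ _).le).trans
        (l2_mul_summable f g).2)

theorem arensRegular_l1PointwiseMul (G : Type*) : ArensRegular (l1PointwiseMul G) :=
  .of_factor (inclusionInDoubleDual_surjective_of_innerProductSpace _) (l1ToL2 G) (l2Mul G)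
    fun _ _ => rfl

/-- Summation over a subset, as a functional on `ℓ¹(G)`. -/
def l1SumOn (S : Set G) : StrongDual ℂ (L1 G) :=
  LinearMap.mkContinuous
    { toFun := fun f => ∑' x, S.indicator f x
      map_add' := fun f g => by
        rw [← ((L1.hasSum_norm f).summable.of_norm.indicator S).tsum_add
          ((L1.hasSum_norm g).summable.of_norm.indicator S)]
        exact tsum_congr fun x => congrFun (Set.indicator_add S f g) x
      map_smul' := fun c f => by
        rw [RingHom.id_apply, smul_eq_mul, ← tsum_mul_left]
        exact tsum_congr fun x => congrFun (Set.indicator_const_smul S c f) x } 1 fun f => by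
    rw [one_mul]
    exact tsum_of_norm_bounded (L1.hasSum_norm f) fun x => norm_indicator_le_norm_self _ _

theorem l1SumOn_single [DecidableEq G] (S : Set G) (a : G) :
    l1SumOn S (lp.single 1 a 1) = S.indicator (fun _ => 1) a := by
  refine (tsum_eq_single a fun x hx => ?_).trans ?_
  · by_cases hS : x ∈ S <;> simp [hS, lp.single_apply, hx]
  · by_cases hS : a ∈ S <;> simp [hS]

end L1Regular

/-! ### Convolution on `ℓ¹(G)`: regular exactly for finite groups -/

section L1Conv

variable {G : Type*} [Group G]

theorem arensRegular_l1ConvMul_of_finite [Finite G] : ArensRegular (l1ConvMul G) := by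
  have : FiniteDimensional ℂ (L1 G) :=
    FiniteDimensional.of_injective
      ({ toFun := fun f => f, map_add' := fun _ _ => rfl, map_smul' := fun _ _ => rfl } :
        L1 G →ₗ[ℂ] (G → ℂ)) (fun _ _ h => lp.ext h)
  exact .of_factor (inclusionInDoubleDual_surjective_of_finiteDimensional (L1 G)) (.id ℂ _)
    (l1ConvMul G) fun _ _ => rfl

open scoped Pointwise in
/-- In an infinite group there are sequences `x`, `y` such that the products `x i * y j` with
`i < j` differ from those with `j < i`. -/
theorem exists_seq_mul_ne [Infinite G] : ∃ x y : ℕ → G,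
    ∀ i j k l, i < j → l < k → x i * y j ≠ x k * y l := by
  classical
  -- The third entry is a finite set containing all earlier `x` and `y`. Each new `x`, and then each
  -- new `y`, avoids the finitely many values that a coincidence of products would force on it; `y`
  -- must also take account of the `x` of its own stage, hence the `insert`.
  let P : G × G × Finset G → Prop := fun s =>
    s.1 ∉ s.2.2 * s.2.2 * s.2.2⁻¹ ∧
      s.2.1 ∉ (insert s.1 s.2.2)⁻¹ * (insert s.1 s.2.2) * (insert s.1 s.2.2)
  let r : G × G × Finset G → G × G × Finset G → Prop := fun s t =>
    s.1 ∈ t.2.2 ∧ s.2.1 ∈ t.2.2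
  obtain ⟨f, hP, hr⟩ := exists_seq_of_forall_finset_exists P r (by
    intro S _
    let F : Finset G := S.image (fun s => s.1) ∪ S.image (fun s => s.2.1)
    obtain ⟨x, hx⟩ := Infinite.exists_notMem_finset (F * F * F⁻¹)
    obtain ⟨y, hy⟩ := Infinite.exists_notMem_finset ((insert x F)⁻¹ * (insert x F) * (insert x F))
    exact ⟨(x, y, F), ⟨hx, hy⟩, fun s hs =>
      ⟨Finset.mem_union_left _ (Finset.mem_image_of_mem (fun s => s.1) hs),
        Finset.mem_union_right _ (Finset.mem_image_of_mem (fun s => s.2.1) hs)⟩⟩)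
  refine ⟨fun n => (f n).1, fun n => (f n).2.1, fun i j k l hij hlk h => ?_⟩
  -- The equation is solved for the factor chosen last: `x k` if `j < k`, and `y j` otherwise, since
  -- `y` is chosen after `x` at an equal stage.
  rcases lt_or_ge j k with hjk | hkj
  · refine (hP k).1 ?_
    rw [show (f k).1 = _ from eq_mul_inv_of_mul_eq h.symm]
    exact Finset.mul_mem_mul (Finset.mul_mem_mul (hr _ _ (hij.trans hjk)).1 (hr _ _ hjk).2)
      (Finset.inv_mem_inv (hr _ _ hlk).2)
  · refine (hP j).2 ?_
    rw [show (f j).2.1 = _ from eq_inv_mul_of_mul_eq h, ← mul_assoc]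
    refine Finset.mul_mem_mul (Finset.mul_mem_mul (Finset.inv_mem_inv ?_) ?_) ?_
    · exact Finset.mem_insert_of_mem (hr _ _ hij).1
    · rcases hkj.eq_or_lt with rfl | hkj
      · exact Finset.mem_insert_self _ _
      · exact Finset.mem_insert_of_mem (hr _ _ hkj).1
    · exact Finset.mem_insert_of_mem (hr _ _ (hlk.trans_le hkj)).2

theorem l1ConvMul_single_single [DecidableEq G] (a b : G) (c d : ℂ) :
    l1ConvMul G (lp.single 1 a c) (lp.single 1 b d) = lp.single 1 (a * b) (c * d) := by
  ext x
  rw [l1ConvMul_apply, conv, tsum_eq_single a]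
  · simp [lp.single_apply, Pi.single_apply, inv_mul_eq_iff_eq_mul]
  · intro y hy
    simp [lp.single_apply, Pi.single_apply, hy]

/-- Convolution of point masses is multiplication in the group, so the functional summing over the
products with `i < j` is `1` on one side of the diagonal and `0` on the other. -/
theorem not_arensRegular_l1ConvMul [Infinite G] : ¬ ArensRegular (l1ConvMul G) := by
  classical
  intro hreg
  obtain ⟨x, y, hxy⟩ := exists_seq_mul_ne (G := G)
  have h := hreg.eq_of_double_limit (a := fun n => lp.single 1 (x n) (1 : ℂ))
    (b := fun n => lp.single 1 (y n) (1 : ℂ)) (C := 1)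
    (fun n => by rw [lp.norm_single one_pos]; simp) (fun n => by rw [lp.norm_single one_pos]; simp)
    (l1SumOn {z | ∃ i j, i < j ∧ z = x i * y j}) (s := 1) (t := 0)
    (fun i j hij => by
      rw [l1ConvMul_single_single, mul_one, l1SumOn_single]
      exact Set.indicator_of_mem (s := {z | ∃ i j, i < j ∧ z = x i * y j}) ⟨i, j, hij, rfl⟩ _)
    (fun k l hlk => by
      rw [l1ConvMul_single_single, mul_one, l1SumOn_single]
      refine Set.indicator_of_notMem ?_ _
      rintro ⟨i, j, hij, h⟩
      exact hxy i j k l hij hlk h.symm)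
  exact one_ne_zero h

theorem arensRegular_l1ConvMul_iff : ArensRegular (l1ConvMul G) ↔ Finite G := by
  refine ⟨fun h => ?_, fun _ => arensRegular_l1ConvMul_of_finite⟩
  by_contra hG
  rw [not_finite_iff_infinite] at hG
  exact not_arensRegular_l1ConvMul h

end L1Conv

/-! ### Density of `ℓ¹(G)` in `A_p(G)` -/

section HerzDense

variable {p : ℝ} {G : Type*} [Group G]

theorem HerzRep.conv_check (hp : 1 < p) (f : LpG G p) (g : LpG G p.conjExponent) :
    HerzRep p (conv g (check f)) (‖f‖ * ‖g‖) :=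
  .of_index hp (fun _ : Unit => f) (fun _ => g) (hasSum_unique _) fun _ => hasSum_unique _

theorem conv_check_single [DecidableEq G] (a b : G) (c d : ℂ) (x : G) :
    conv (lp.single (ENNReal.ofReal p.conjExponent) a c : G → ℂ)
      (check (lp.single (ENNReal.ofReal p) b d : G → ℂ)) x = if x = a * b⁻¹ then c * d else 0 := by
  rw [conv_check, tsum_eq_single a]
  · have : x⁻¹ * a = b ↔ x = a * b⁻¹ := by
      rw [inv_mul_eq_iff_eq_mul, eq_mul_inv_iff_mul_eq, eq_comm]
    simp [lp.single_apply, Pi.single_apply, this]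
  · intro y hy
    simp [lp.single_apply, Pi.single_apply, hy]

variable [hp : Fact (1 < p)]

instance fact_one_le_ofReal : Fact (1 ≤ ENNReal.ofReal p) :=
  ⟨ENNReal.one_le_ofReal.2 hp.out.le⟩

instance fact_one_le_ofReal_conjExponent : Fact (1 ≤ ENNReal.ofReal p.conjExponent) :=
  ⟨ENNReal.one_le_ofReal.2 (hconj hp.out).symm.lt.le⟩

/-- The bilinear map `(g, f) ↦ g * f^∨` from `ℓ^q(G) × ℓ^p(G)` to `A_p(G)`. -/
def herzConv (p : ℝ) [hp : Fact (1 < p)] (G : Type*) [Group G] :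
    LpG G p.conjExponent →L[ℂ] LpG G p →L[ℂ] HerzAlgebra p G :=
  LinearMap.mkContinuous₂
    (LinearMap.mk₂ ℂ
      (fun g f => (⟨conv g (check f), _, .conv_check hp.out f g⟩ : HerzAlgebra p G))
      (fun g g' f => HerzAlgebra.ext fun x => by
        change conv _ _ _ = conv _ _ _ + conv _ _ _
        simp only [conv_check]
        exact (tsum_congr fun y => add_mul (g y) (g' y) _).trans
          ((conv_summable hp.out f g x).1.of_norm.tsum_add
            (conv_summable hp.out f g' x).1.of_norm))
      (fun c g f => HerzAlgebra.ext fun x => by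
        change conv _ _ _ = c * conv _ _ _
        simp only [conv_check]
        exact (tsum_congr fun y => mul_assoc c (g y) _).trans tsum_mul_left)
      (fun g f f' => HerzAlgebra.ext fun x => by
        change conv _ _ _ = conv _ _ _ + conv _ _ _
        simp only [conv_check]
        exact (tsum_congr fun y => mul_add (g y) (f _) (f' _)).trans
          ((conv_summable hp.out f g x).1.of_norm.tsum_add
            (conv_summable hp.out f' g x).1.of_norm))
      (fun c g f => HerzAlgebra.ext fun x => by
        change conv _ _ _ = c * conv _ _ _
        simp only [conv_check]
        exact (tsum_congr fun y => mul_left_comm (g y) c (f _)).trans tsum_mul_left))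
    1 (fun g f => by
      rw [one_mul, mul_comm]
      exact herzNorm_le (.conv_check hp.out f g))

theorem herzConv_apply (g : LpG G p.conjExponent) (f : LpG G p) (x : G) :
    herzConv p G g f x = conv g (check f) x := rfl

theorem HerzAlgebra.coe_sum {ι : Type*} (s : Finset ι) (F : ι → HerzAlgebra p G) (x : G) :
    (∑ i ∈ s, F i : HerzAlgebra p G) x = ∑ i ∈ s, F i x :=
  map_sum ({ toFun := fun u => u x, map_zero' := rfl, map_add' := fun _ _ => rfl } :
    HerzAlgebra p G →+ ℂ) F s

/-- A representation of `u` is given as a pointwise sum, but it converges in the Herz norm: after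
finitely many terms are removed, the rest represents the remainder, whose norm is therefore at most
the tail of the series for `r`. -/
theorem HerzAlgebra.exists_hasSum_herzConv (u : HerzAlgebra p G) :
    ∃ (f : ℕ → LpG G p) (g : ℕ → LpG G p.conjExponent),
      HasSum (fun i => herzConv p G (g i) (f i)) u := by
  obtain ⟨r, f, g, hr, hu⟩ := u.2
  refine ⟨f, g, ?_⟩
  have key : ∀ s : Finset ℕ, ‖∑ i ∈ s, herzConv p G (g i) (f i) - u‖ ≤
      r - ∑ i ∈ s, ‖f i‖ * ‖g i‖ := by
    intro s
    rw [norm_sub_rev]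
    refine herzNorm_le (.of_index hp.out (fun i : {i // i ∉ s} => f i) (fun i => g i) ?_ fun x => ?_)
    · refine (s.hasSum_compl_iff (f := fun i => ‖f i‖ * ‖g i‖)).2 ?_
      rwa [sub_add_cancel]
    · refine (s.hasSum_compl_iff (f := fun i => conv (g i) (check (f i)) x)).2 ?_
      have e : (u - ∑ i ∈ s, herzConv p G (g i) (f i) : HerzAlgebra p G) x =
          u x - ∑ i ∈ s, conv (g i) (check (f i)) x := by
        change u x - (∑ i ∈ s, herzConv p G (g i) (f i) : HerzAlgebra p G) x = _
        rw [HerzAlgebra.coe_sum]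
        rfl
      rw [e, sub_add_cancel]
      exact hu x
  refine tendsto_iff_norm_sub_tendsto_zero.2
    (squeeze_zero (fun _ => norm_nonneg _) key ?_)
  simpa using (tendsto_const_nhds (x := r)).sub hr

/-- `ℓ¹(G)` is dense in `A_p(G)`. -/
theorem HerzL1.denseRange_incl : DenseRange (HerzL1.incl p G) := by
  classical
  let S : Submodule ℂ (HerzAlgebra p G) := (LinearMap.range (HerzL1.incl p G)).topologicalClosure
  have hS : IsClosed (S : Set (HerzAlgebra p G)) := Submodule.isClosed_topologicalClosure _
  -- Point masses convolve to point masses, which lie in `ℓ¹(G)`. Finitely supported functions are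
  -- dense in `ℓ^q` and `ℓ^p`, both exponents being finite, so closedness of `S` and continuity of
  -- `herzConv` remove the restriction from one factor at a time.
  have h1 : ∀ a c b d, herzConv p G (lp.single _ a c) (lp.single _ b d) ∈ S := by
    intro a c b d
    refine Submodule.le_topologicalClosure _
      ⟨toHerzL1 p G (lp.single 1 (a * b⁻¹) (c * d)), HerzAlgebra.ext fun x => ?_⟩
    rw [herzConv_apply, conv_check_single]
    exact Pi.single_apply (a * b⁻¹) (c * d) x
  have h2 : ∀ g b d, herzConv p G g (lp.single _ b d) ∈ S := by
    intro g b d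
    have h := (lp.hasSum_single ENNReal.ofReal_ne_top g).mapL
      ((herzConv p G).flip (lp.single _ b d))
    exact hS.mem_of_tendsto h (.of_forall fun s => S.sum_mem fun i _ => h1 i _ b d)
  have h3 : ∀ g f, herzConv p G g f ∈ S := by
    intro g f
    have h := (lp.hasSum_single ENNReal.ofReal_ne_top f).mapL (herzConv p G g)
    exact hS.mem_of_tendsto h (.of_forall fun s => S.sum_mem fun i _ => h2 g i _)
  intro u
  obtain ⟨f, g, h⟩ := u.exists_hasSum_herzConv
  exact hS.mem_of_tendsto h (.of_forall fun s => S.sum_mem fun i _ => h3 _ _)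

end HerzDense

/-! ### The Herz norm on `ℓ¹(G)`: regularity, and convolution on `ℤ` -/

section HerzRegular

variable (p : ℝ) [hp : Fact (1 < p)] (G : Type*) [Group G]

theorem arensRegular_herzL1Mul_iff : ArensRegular (herzL1Mul p G) ↔ ArensRegular (herzMul p G) :=
  arensRegular_iff_of_denseRange (D := HerzL1 p G)
    { HerzL1.incl p G with norm_map' := fun _ => rfl } HerzL1.denseRange_incl fun _ _ => rfl

theorem LpG.norm_single_add_single {p : ℝ} [hp : Fact (1 < p)] {G : Type*} [DecidableEq G]
    {a b : G} (hab : a ≠ b) :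
    ‖(lp.single _ a 1 + lp.single _ b 1 : LpG G p)‖ = 2 ^ p⁻¹ := by
  have hp0 : 0 < p := one_pos.trans hp.out
  have h := lp.norm_sum_single (p := ENNReal.ofReal p) (E := fun _ : G => ℂ)
    (by rwa [ENNReal.toReal_ofReal hp0.le]) (fun _ => 1) {a, b}
  rw [Finset.sum_pair hab, Finset.sum_pair hab, ENNReal.toReal_ofReal hp0.le] at h
  rw [← Real.rpow_rpow_inv (norm_nonneg _) hp0.ne', h]
  norm_num

/-- Convolution is not submultiplicative for the norm of `A_p(ℤ)`: with `v = δ₀ + δ₁`, the function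
`u = v * v^∨ = 2 δ₀ + δ₁ + δ₋₁` has norm at most `2`, but `(u * u)(0) = 6`. -/
theorem exists_herzL1Conv_norm_gt :
    ∃ f : HerzL1 p (Multiplicative ℤ), ‖f‖ * ‖f‖ < ‖herzL1Conv p (Multiplicative ℤ) f f‖ := by
  let t : Multiplicative ℤ := .ofAdd 1
  have ht : (1 : Multiplicative ℤ) ≠ t := by decide
  have : Fact (1 < p.conjExponent) := ⟨(hconj hp.out).symm.lt⟩
  let v : LpG (Multiplicative ℤ) p := lp.single _ 1 1 + lp.single _ t 1
  let w : LpG (Multiplicative ℤ) p.conjExponent := lp.single _ 1 1 + lp.single _ t 1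
  let u : L1 (Multiplicative ℤ) := lp.single _ 1 2 + lp.single _ t 1 + lp.single _ t⁻¹ 1
  have hu : (u : Multiplicative ℤ → ℂ) = conv w (check v) := by
    funext x
    have e : herzConv p _ w v x = conv w (check v) x := rfl
    rw [← e]
    simp only [w, v, map_add, add_apply]
    change _ = (conv _ _ x + conv _ _ x) + (conv _ _ x + conv _ _ x)
    rw [conv_check_single, conv_check_single, conv_check_single, conv_check_single]
    simp only [u, lp.coeFn_add, Pi.add_apply, lp.single_apply, Pi.single_apply]
    simp
    split_ifs <;> ring
  have h1 : ‖toHerzL1 p _ u‖ ≤ 2 := by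
    rw [HerzL1.norm_def, LinearEquiv.symm_apply_apply, hu]
    refine (herzNorm_le (.conv_check hp.out v w)).trans_eq ?_
    -- The bound is `2^(1/p) · 2^(1/q) = 2`, which does not depend on `p`.
    rw [LpG.norm_single_add_single ht, LpG.norm_single_add_single ht,
      ← Real.rpow_add two_pos, (hconj hp.out).inv_add_inv_eq_one, Real.rpow_one]
  have h2 : 6 ≤ ‖herzL1Conv p _ (toHerzL1 p _ u) (toHerzL1 p _ u)‖ := by
    have h := norm_apply_le_herzNorm hp.out ⟨_, .of_l1 hp.out (l1ConvMul _ u u)⟩ 1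
    -- Only the pairs `(1, 1)`, `(t, t⁻¹)` and `(t⁻¹, t)` multiply to the identity, contributing `4
    -- + 1 + 1`.
    have e : l1ConvMul _ u u 1 = 6 := by
      simp only [u, map_add, add_apply, l1ConvMul_single_single,
        lp.coeFn_add, Pi.add_apply, lp.single_apply, Pi.single_apply]
      have h3 : (1 : Multiplicative ℤ) ≠ t⁻¹ := by decide
      have h4 : (1 : Multiplicative ℤ) ≠ t * t := by decide
      have h5 : (1 : Multiplicative ℤ) ≠ t⁻¹ * t⁻¹ := by decide
      simp [ht, h3, h4, h5]
      norm_num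
    rw [e] at h
    exact le_trans (by norm_num) h
  refine ⟨toHerzL1 p _ u, ?_⟩
  -- The product of the norms is at most `4`, below `6`.
  nlinarith [norm_nonneg (toHerzL1 p _ u)]

end HerzRegular

end

theorem theorem3p6 (G : Type*) [Group G] (p : ℝ) [Fact (1 < p)] :
    ArensRegular (l1PointwiseMul G) ∧
    (ArensRegular (l1ConvMul G) ↔ Finite G) ∧
    (¬ ∀ f g : HerzL1 p (Multiplicative ℤ),
      ‖herzL1Conv p (Multiplicative ℤ) f g‖ ≤ ‖f‖ * ‖g‖) ∧
    (ArensRegular (herzL1Mul p G) ↔ ArensRegular (herzMul p G)) := by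
  refine ⟨arensRegular_l1PointwiseMul G, arensRegular_l1ConvMul_iff, fun h => ?_,
    arensRegular_herzL1Mul_iff p G⟩
  obtain ⟨f, hf⟩ := exists_herzL1Conv_norm_gt p
  exact (h f f).not_gt hf
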